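/- Let $M,N_1,N_2,L_S$ be natural numbers with $N_1,N_2\ge 1$ and $L_S\ge N_1+N_2$; let $q,\tau_1,\tau_2>0$. For $i=1,2$ let $Z_{t,H_i}\in\mathbb C^{N_i\times N_i}$ be Hermitian positive definite with an eigendecomposition $Z_{t,H_i}=U_{t,H_i}\,\mathrm{Diag}(\sigma_{t,H_i,1},\dots,\sigma_{t,H_i,N_i})\,U_{t,H_i}^H$, $U_{t,H_i}$ unitary. Let $Z_{r,H}\in\mathbb C^{M\times M}$ be nonzero and positive semidefinite, $K_{r,R}\in\mathbb C^{M\times M}$ positive definite, with common eigenvectors: $Z_{r,H}=U_{r,H}\,\mathrm{Diag}(\sigma_{r,H,n})\,U_{r,H}^H$ and $K_{r,R}=U_{r,H}\,\mathrm{Diag}(\delta_{r,R,n})\,U_{r,H}^H$ with $U_{r,H}$ unitary. Put $\alpha_n=\sigma_{r,H,n}/(q\,\delta_{r,R,n})$ and $Z_{t,H}=\mathrm{Blkdiag}(Z_{t,H_1},Z_{t,H_2})$. For $S_i\in\mathbb C^{N_i\times L_S}$ and $S=[S_1^T,S_2^T]^T$, with $^*$ the entrywise conjugate, consider the training design problem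 for temporal disturbance covariance $K_{q,R}=qI$: $$\min_{S_1,S_2}\ \sum_{n=1}^M\sigma_{r,H,n}\,\mathrm{Tr}\Big[\big(Z_{t,H}^{-1}+\alpha_n S^*S^T\big)^{-1}\Big]\quad\text{s.t.}\quad \mathrm{Tr}(E_iS^*S^T)\le\tau_i,\ i=1,2,\qquad(\mathrm P)$$ where $E_1=\mathrm{Blkdiag}(I_{N_1},0)$ and $E_2=\mathrm{Blkdiag}(0,I_{N_2})$ (so the constraints are $\mathrm{Tr}(S_iS_i^H)\le\tau_i$). Then: 1. (P) has a minimizer, and every minimizer satisfies $S_1^*S_2^T=0$. 2. For each $i$ there are a unique multiplier $\lambda_i$ and unique numbers $\sigma_{s_i,m}\ge0$, $1\le m\le N_i$, with $\sum_{m=1}^{N_i}\sigma_{s_i,m}^2=\tau_i$ that solve the water-filling problem $$\sum_{n=1}^M\frac{\alpha_n\,\sigma_{r,H,n}\,\sigma_{t,H_i,m}^2}{(1+\alpha_n\,\sigma_{t,H_i,m}\,\sigma_{s_i,m}^2)^2}=\lambda_i\ \text{ whenever }\sigma_{s_i,m}>0,\qquad \sum_{n=1}^M\alpha_n\,\sigma_{r,H,n}\,\sigma_{t,H_i,m}^2\le\lambda_i\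 \text{ whenever }\sigma_{s_i,m}=0 .$$ 3. A pair $(S_1,S_2)$ is a minimizer of (P) if and only if $S_i=U_{t,H_i}^*\,\Sigma_{s_i}\,V_{s_i}^H$ for $i=1,2$, where $\Sigma_{s_i}=\mathrm{Diag}(\sigma_{s_i,1},\dots,\sigma_{s_i,N_i})$ is the water-filling solution of part 2, and the matrices $V_{s_i}\in\mathbb C^{L_S\times N_i}$ satisfy $V_{s_i}^HV_{s_i}=I$ and $V_{s_1}^HV_{s_2}=0$. -/

import Mathlib

open scoped Matrix ComplexOrder

namespace MAC

/-- Entrywise complex conjugate `A^*` of a complex matrix (not the conjugate transpose). -/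
def conj {m n : Type*} (A : Matrix m n ℂ) : Matrix m n ℂ := A.map (starRingEnd ℂ)

/-- `Z = U Σ Uᴴ` with `U` unitary and `Σ` the diagonal matrix of the real numbers `d n`. -/
def IsEigendecomposition {N : ℕ} (Z U : Matrix (Fin N) (Fin N) ℂ) (d : Fin N → ℝ) : Prop :=
  U ∈ Matrix.unitaryGroup (Fin N) ℂ ∧ Z = U * Matrix.diagonal (fun n => (d n : ℂ)) * Uᴴ

/-- `α_n = σ_{r,H,n} / (q δ_{r,R,n})`. -/
noncomputable def alpha {M : ℕ} (q : ℝ) (sigmaR deltaR : Fin M → ℝ) (n : Fin M) : ℝ :=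
  sigmaR n / (q * deltaR n)

/-- `S^* S^T` for the stacked training matrix `S = [S₁; S₂]`. -/
def gram {N₁ N₂ L : ℕ} (S₁ : Matrix (Fin N₁) (Fin L) ℂ) (S₂ : Matrix (Fin N₂) (Fin L) ℂ) :
    Matrix (Fin N₁ ⊕ Fin N₂) (Fin N₁ ⊕ Fin N₂) ℂ :=
  conj (Matrix.fromRows S₁ S₂) * (Matrix.fromRows S₁ S₂)ᵀ

/-- The total mean-square error
`∑ₙ σ_{r,H,n} Tr[(Z_{t,H}⁻¹ + α_n S^* S^T)⁻¹]`, where `Z_{t,H} = Blkdiag(Z_{t,H₁}, Z_{t,H₂})`.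
The trace is that of a Hermitian matrix, hence real. -/
noncomputable def mse {M N₁ N₂ L : ℕ} (Z₁ : Matrix (Fin N₁) (Fin N₁) ℂ)
    (Z₂ : Matrix (Fin N₂) (Fin N₂) ℂ) (q : ℝ) (sigmaR deltaR : Fin M → ℝ)
    (S₁ : Matrix (Fin N₁) (Fin L) ℂ) (S₂ : Matrix (Fin N₂) (Fin L) ℂ) : ℝ :=
  ∑ n, sigmaR n *
    (Matrix.trace (((Matrix.fromBlocks Z₁ 0 0 Z₂)⁻¹
      + (alpha q sigmaR deltaR n : ℂ) • gram S₁ S₂)⁻¹)).re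

/-- The two source power constraints `Tr(E_i S^* S^T) ≤ τ_i`, with
`E₁ = Blkdiag(I, 0)` and `E₂ = Blkdiag(0, I)`. -/
def Feasible {N₁ N₂ L : ℕ} (τ₁ τ₂ : ℝ)
    (S₁ : Matrix (Fin N₁) (Fin L) ℂ) (S₂ : Matrix (Fin N₂) (Fin L) ℂ) : Prop :=
  (Matrix.trace (Matrix.fromBlocks 1 0 0 0 * gram S₁ S₂)).re ≤ τ₁ ∧
  (Matrix.trace (Matrix.fromBlocks 0 0 0 1 * gram S₁ S₂)).re ≤ τ₂

/-- `(S₁, S₂)` is a global minimizer of the total mean-square error under the power constraints. -/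
def IsOptimal {M N₁ N₂ L : ℕ} (Z₁ : Matrix (Fin N₁) (Fin N₁) ℂ)
    (Z₂ : Matrix (Fin N₂) (Fin N₂) ℂ) (q : ℝ) (sigmaR deltaR : Fin M → ℝ) (τ₁ τ₂ : ℝ)
    (S₁ : Matrix (Fin N₁) (Fin L) ℂ) (S₂ : Matrix (Fin N₂) (Fin L) ℂ) : Prop :=
  Feasible τ₁ τ₂ S₁ S₂ ∧
  ∀ (T₁ : Matrix (Fin N₁) (Fin L) ℂ) (T₂ : Matrix (Fin N₂) (Fin L) ℂ),
    Feasible τ₁ τ₂ T₁ T₂ →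
      mse Z₁ Z₂ q sigmaR deltaR S₁ S₂ ≤ mse Z₁ Z₂ q sigmaR deltaR T₁ T₂

/-- `∑ₙ α_n σ_{r,H,n} t² / (1 + α_n t s²)²`, for an eigenvalue `t` and a loading `s`. -/
noncomputable def level {M : ℕ} (q : ℝ) (sigmaR deltaR : Fin M → ℝ) (t s : ℝ) : ℝ :=
  ∑ n, alpha q sigmaR deltaR n * sigmaR n * t ^ 2 / (1 + alpha q sigmaR deltaR n * t * s ^ 2) ^ 2

/-- The loading `s` solves the water-filling problem for the eigenvalues `t` with multiplier `lam`
and total power `τ`: the water-filling equation holds at each mode that carries power, and a mode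
carries no power only if its level at zero does not exceed the multiplier. -/
structure IsWaterFilling {M N : ℕ} (q : ℝ) (sigmaR deltaR : Fin M → ℝ) (t : Fin N → ℝ) (τ : ℝ)
    (lam : ℝ) (s : Fin N → ℝ) : Prop where
  nonneg : ∀ m, 0 ≤ s m
  active : ∀ m, 0 < s m → level q sigmaR deltaR (t m) (s m) = lam
  inactive : ∀ m, s m = 0 → level q sigmaR deltaR (t m) (s m) ≤ lam
  power : ∑ m, s m ^ 2 = τ

/-- `S = U^* Σ Vᴴ`, with `Σ` the diagonal matrix of the real loading `s`. -/
def HasForm {N L : ℕ} (U : Matrix (Fin N) (Fin N) ℂ) (s : Fin N → ℝ)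
    (V : Matrix (Fin L) (Fin N) ℂ) (S : Matrix (Fin N) (Fin L) ℂ) : Prop :=
  S = conj U * Matrix.diagonal (fun m => (s m : ℂ)) * Vᴴ

end MAC

/-! The objective and the constraints depend on the training matrices only through `Q = S^* S^T`,
and the objective is convex in `Q`. The proof makes this convexity exact: for invertible `X`, `Y`,
the trace of `X⁻¹` is its tangent at `Y` plus the trace of `(X⁻¹ - Y⁻¹) X (X⁻¹ - Y⁻¹)`
(`trace_inv_sub_tangent`).

Expand at `Q₀ = U Diag(s²) Uᴴ`, where `U = Blkdiag(U₁, U₂)` and `s` collects the two water-filling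
loadings. The tangent term then sees only the diagonal of `Uᴴ Q U`, weighted by the water levels.
The levels of source `i` are at most `λ_i`, with equality where power is placed, so the trace
constraints show that no feasible `Q` gains to first order (`IsWaterFilling.sum_level_mul_le`). The
remainder is nonnegative, and it vanishes only at `Q = Q₀` because some `σ_n α_n > 0`
(`errorSum_gap_nonneg`). Hence the minimizers are exactly the matrices with Gram matrix `Q₀`. Its
block diagonal shape is the orthogonality of the sources, and factoring it, which is possible since
`L ≥ N₁ + N₂`, gives the stated form (`gram_eq_specMat_iff`).

The water-filling system is solved by minimizing the separable error over a simplex of powers;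
strict monotonicity of the levels gives uniqueness. -/

namespace MAC

/-! ### Existence and uniqueness of the water-filling solution -/

section WaterFilling

variable {M N : ℕ} {q : ℝ} {sigmaR deltaR : Fin M → ℝ}

theorem level_strictAnti (hσ : ∀ n, 0 ≤ sigmaR n) (hα : ∀ n, 0 ≤ alpha q sigmaR deltaR n)
    (hpos : ∃ n, 0 < sigmaR n ∧ 0 < alpha q sigmaR deltaR n) {t : ℝ} (ht : 0 < t)
    {x y : ℝ} (hx : 0 ≤ x) (hxy : x < y) :
    level q sigmaR deltaR t y < level q sigmaR deltaR t x := by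
  have hsq : x ^ 2 < y ^ 2 := by gcongr
  unfold level
  apply Finset.sum_lt_sum
  · intro n _
    have h1 := hα n
    have h2 := hσ n
    gcongr
  · obtain ⟨n, h2, h1⟩ := hpos
    refine ⟨n, Finset.mem_univ _, ?_⟩
    apply div_lt_div_of_pos_left (by positivity) (by positivity)
    gcongr

theorem IsWaterFilling.level_le {t : Fin N → ℝ} {τ lam : ℝ} {s : Fin N → ℝ}
    (h : IsWaterFilling q sigmaR deltaR t τ lam s) (m : Fin N) :
    level q sigmaR deltaR (t m) (s m) ≤ lam := by
  rcases (h.nonneg m).eq_or_lt with h0 | h0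
  · exact h.inactive m h0.symm
  · exact (h.active m h0).le

theorem IsWaterFilling.exists_pos {t : Fin N → ℝ} {τ lam : ℝ} {s : Fin N → ℝ}
    (h : IsWaterFilling q sigmaR deltaR t τ lam s) (hτ : 0 < τ) : ∃ m, 0 < s m := by
  by_contra! hc
  have : ∑ m, s m ^ 2 = 0 :=
    Finset.sum_eq_zero fun m _ => by rw [le_antisymm (hc m) (h.nonneg m)]; simp
  linarith [h.power]

/-- The larger multiplier forces no more power into any mode, yet both totals equal `τ`, so the
loadings agree mode by mode. Since `τ > 0`, some mode is active, and its level is both multipliers.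
-/
theorem IsWaterFilling.unique_of_le (hσ : ∀ n, 0 ≤ sigmaR n)
    (hα : ∀ n, 0 ≤ alpha q sigmaR deltaR n)
    (hpos : ∃ n, 0 < sigmaR n ∧ 0 < alpha q sigmaR deltaR n)
    {t : Fin N → ℝ} (ht : ∀ m, 0 < t m) {τ lam lam' : ℝ} (hτ : 0 < τ) {s s' : Fin N → ℝ}
    (h : IsWaterFilling q sigmaR deltaR t τ lam s)
    (h' : IsWaterFilling q sigmaR deltaR t τ lam' s') (hle : lam ≤ lam') :
    lam = lam' ∧ s = s' := by
  -- If `s m < s' m`, then mode `m` is active for `s'`, so its level there is `lam' ≥ lam`, although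
  -- strict decrease puts it below the level at `s m`, which is at most `lam`.
  have hs : ∀ m, s' m ≤ s m := by
    intro m
    by_contra! hlt
    have h1 := level_strictAnti hσ hα hpos (ht m) (h.nonneg m) hlt
    have h2 := h'.active m ((h.nonneg m).trans_lt hlt)
    linarith [h.level_le m]
  have hsq : ∀ m ∈ Finset.univ, s' m ^ 2 = s m ^ 2 :=
    (Finset.sum_eq_sum_iff_of_le
      fun m _ => pow_le_pow_left₀ (h'.nonneg m) (hs m) 2).1 (h'.power.trans h.power.symm)
  have hss : s = s' := funext fun m =>
    ((pow_left_inj₀ (h'.nonneg m) (h.nonneg m) two_ne_zero).1 (hsq m (Finset.mem_univ m))).symm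
  subst hss
  obtain ⟨m, hm⟩ := h.exists_pos hτ
  exact ⟨(h.active m hm).symm.trans (h'.active m hm), rfl⟩

/-- Identifies the water level as the marginal error reduction of one mode. The variable is the
power `y = s²`, hence the loading `√x`. -/
theorem hasDerivAt_modeError (hα : ∀ n, 0 ≤ alpha q sigmaR deltaR n) {t : ℝ} (ht : 0 < t)
    {x : ℝ} (hx : 0 ≤ x) :
    HasDerivAt (fun y => ∑ n, sigmaR n * (t / (1 + alpha q sigmaR deltaR n * t * y)))
      (-level q sigmaR deltaR t (√x)) x := by
  unfold level
  rw [← Finset.sum_neg_distrib]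
  apply HasDerivAt.fun_sum
  intro n _
  have hd : 1 + alpha q sigmaR deltaR n * t * x ≠ 0 := by
    have := hα n
    positivity
  have h1 : HasDerivAt (fun y => 1 + alpha q sigmaR deltaR n * t * y)
      (alpha q sigmaR deltaR n * t) x := by
    simpa using ((hasDerivAt_id x).const_mul (alpha q sigmaR deltaR n * t)).const_add 1
  have h2 := (((hasDerivAt_const x t).fun_div h1 hd).const_mul (sigmaR n))
  refine h2.congr_deriv ?_
  rw [Real.sq_sqrt hx]
  ring

/-- First-order conditions at a minimizer of a separable function over a scaled simplex. -/
theorem marginal_le_of_isMinOn_simplex {ι : Type*} [Fintype ι] [DecidableEq ι]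
    {φ l : ι → ℝ → ℝ} (hφ : ∀ j x, 0 ≤ x → HasDerivAt (φ j) (-l j x) x) {τ : ℝ} {x : ι → ℝ}
    (hx : ∀ j, 0 ≤ x j) (hxτ : ∑ j, x j = τ)
    (hmin : ∀ y : ι → ℝ, (∀ j, 0 ≤ y j) → ∑ j, y j = τ → ∑ j, φ j (x j) ≤ ∑ j, φ j (y j))
    {m : ι} (hm : 0 < x m) (k : ι) : l k (x k) ≤ l m (x m) := by
  -- Transfer of power from mode `m` to mode `k`. It stays in the simplex for `0 < ε < x m`, so
  -- minimality makes the right derivative at `0` nonnegative.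
  let d : ι → ℝ := Pi.single k 1 - Pi.single m 1
  have hd : HasDerivAt (fun ε : ℝ => ∑ j, φ j (x j + ε * d j)) (∑ j, -l j (x j) * d j) 0 := by
    apply HasDerivAt.fun_sum
    intro j _
    have h1 : HasDerivAt (fun ε : ℝ => x j + ε * d j) (d j) 0 := by
      simpa using ((hasDerivAt_id (0 : ℝ)).mul_const (d j)).const_add (x j)
    have h2 : HasDerivAt (φ j) (-l j (x j)) (x j + 0 * d j) := by
      simpa using hφ j (x j) (hx j)
    exact h2.comp (0 : ℝ) h1
  have hval : ∑ j, -l j (x j) * d j = l m (x m) - l k (x k) := by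
    simp only [d, Pi.sub_apply, mul_sub, Finset.sum_sub_distrib, Pi.single_apply, mul_ite,
      mul_one, mul_zero, Finset.sum_ite_eq', Finset.mem_univ, if_true]
    ring
  rw [hval] at hd
  have hev : ∀ᶠ ε in nhdsWithin (0 : ℝ) (Set.Ioi 0),
      0 ≤ slope (fun ε : ℝ => ∑ j, φ j (x j + ε * d j)) 0 ε := by
    filter_upwards [Ioo_mem_nhdsGT hm] with ε hε
    rw [slope_def_field]
    apply div_nonneg _ (by linarith [hε.1])
    have := hmin (fun j => x j + ε * d j) (fun j => ?_) ?_
    · simpa using this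
    · have h0 := hx j
      have h1 : 0 ≤ (Pi.single k (1 : ℝ) : ι → ℝ) j := by
        rw [Pi.single_apply]; split_ifs <;> norm_num
      by_cases hj : j = m
      · subst hj
        simp only [d, Pi.sub_apply, Pi.single_eq_same]
        nlinarith [hε.1, hε.2, mul_nonneg hε.1.le h1]
      · simp only [d, Pi.sub_apply, Pi.single_eq_of_ne hj, sub_zero]
        have := mul_nonneg hε.1.le h1
        linarith
    · rw [Finset.sum_add_distrib, ← Finset.mul_sum, hxτ]
      simp [d]
  have htend := (hasDerivAt_iff_tendsto_slope.1 hd).mono_left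
    (nhdsWithin_mono (0 : ℝ) (fun ε (hε : ε ∈ Set.Ioi 0) => (Set.mem_Ioi.1 hε).ne'))
  linarith [ge_of_tendsto htend hev]

/-- The total error attains its minimum on the compact simplex of powers `x = s²`. By the
first-order conditions every mode that carries power has the largest level, and this common value
serves as the multiplier. -/
theorem exists_isWaterFilling (hα : ∀ n, 0 ≤ alpha q sigmaR deltaR n) (hN : 0 < N)
    {t : Fin N → ℝ} (ht : ∀ m, 0 < t m) {τ : ℝ} (hτ : 0 < τ) :
    ∃ lam s, IsWaterFilling q sigmaR deltaR t τ lam s := by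
  let φ : Fin N → ℝ → ℝ := fun m y =>
    ∑ n, sigmaR n * (t m / (1 + alpha q sigmaR deltaR n * t m * y))
  have hφ : ∀ m x, 0 ≤ x → HasDerivAt (φ m) (-level q sigmaR deltaR (t m) (√x)) x :=
    fun m x hx => hasDerivAt_modeError hα (ht m) hx
  let K : Set (Fin N → ℝ) := {x | (∀ m, 0 ≤ x m) ∧ ∑ m, x m = τ}
  have hK : IsCompact K := by
    refine IsCompact.of_isClosed_subset (isCompact_Icc (a := (0 : Fin N → ℝ))
      (b := fun _ => τ)) ?_ ?_
    · refine IsClosed.inter (isClosed_Ici (a := (0 : Fin N → ℝ))) ?_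
      exact isClosed_eq (by fun_prop) continuous_const
    · rintro x ⟨h0, h1⟩
      refine ⟨h0, fun m => ?_⟩
      rw [← h1]
      exact Finset.single_le_sum (fun j _ => h0 j) (Finset.mem_univ m)
  have hne : K.Nonempty := by
    refine ⟨Pi.single ⟨0, hN⟩ τ, fun m => ?_, by simp⟩
    rw [Pi.single_apply]
    split_ifs
    · exact hτ.le
    · exact le_rfl
  have hcont : ContinuousOn (fun x : Fin N → ℝ => ∑ m, φ m (x m)) K := by
    refine continuousOn_finsetSum _ fun m _ x hx => ?_
    have h1 : ContinuousAt (φ m) (x m) := (hφ m (x m) (hx.1 m)).continuousAt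
    exact (ContinuousAt.comp (f := fun x : Fin N → ℝ => x m) h1
      (continuous_apply m).continuousAt).continuousWithinAt
  obtain ⟨x, hxK, hmin⟩ := hK.exists_isMinOn hne hcont
  have hmarg : ∀ m, 0 < x m → ∀ k,
      level q sigmaR deltaR (t k) (√(x k)) ≤ level q sigmaR deltaR (t m) (√(x m)) :=
    fun m hm k => marginal_le_of_isMinOn_simplex
      (l := fun m x => level q sigmaR deltaR (t m) (√x)) hφ hxK.1 hxK.2
      (fun y h0 h1 => hmin ⟨h0, h1⟩) hm k
  obtain ⟨m₀, hm₀⟩ : ∃ m, 0 < x m := by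
    by_contra! hc
    have : ∑ m, x m ≤ 0 := Finset.sum_nonpos fun m _ => hc m
    linarith [hxK.2]
  refine ⟨level q sigmaR deltaR (t m₀) (√(x m₀)), fun m => √(x m), ⟨fun m => Real.sqrt_nonneg _,
    fun m hm => ?_, fun m _ => hmarg m₀ hm₀ m, ?_⟩⟩
  · exact le_antisymm (hmarg m₀ hm₀ m) (hmarg m (Real.sqrt_pos.1 hm) m₀)
  · rw [← hxK.2]
    exact Finset.sum_congr rfl fun m _ => Real.sq_sqrt (hxK.1 m)

theorem existsUnique_isWaterFilling (hσ : ∀ n, 0 ≤ sigmaR n)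
    (hα : ∀ n, 0 ≤ alpha q sigmaR deltaR n)
    (hpos : ∃ n, 0 < sigmaR n ∧ 0 < alpha q sigmaR deltaR n) (hN : 0 < N)
    {t : Fin N → ℝ} (ht : ∀ m, 0 < t m) {τ : ℝ} (hτ : 0 < τ) :
    ∃! p : ℝ × (Fin N → ℝ), IsWaterFilling q sigmaR deltaR t τ p.1 p.2 := by
  obtain ⟨lam, s, h⟩ := exists_isWaterFilling (sigmaR := sigmaR) hα hN ht hτ
  refine ⟨(lam, s), h, fun p hp => ?_⟩
  rcases le_total p.1 lam with hle | hle
  · obtain ⟨h1, h2⟩ := hp.unique_of_le hσ hα hpos ht hτ h hle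
    exact Prod.ext h1 h2
  · obtain ⟨h1, h2⟩ := h.unique_of_le hσ hα hpos ht hτ hp hle
    exact Prod.ext h1.symm h2.symm

end WaterFilling

end MAC

namespace MAC

/-! ### Tangent inequality for the trace of the inverse -/

section Trace

variable {ι : Type*} [Fintype ι]

theorem trace_re_mul_mul_nonneg {X D : Matrix ι ι ℂ} (hX : X.PosDef) (hD : D.IsHermitian) :
    0 ≤ (D * X * D).trace.re := by
  have h := (hX.posSemidef.conjTranspose_mul_mul_same D).trace_nonneg
  rw [hD.eq] at h
  exact (Complex.le_def.1 h).1

variable [DecidableEq ι]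

theorem eq_zero_of_trace_re_mul_mul_eq_zero {X D : Matrix ι ι ℂ} (hX : X.PosDef)
    (hD : D.IsHermitian) (h0 : (D * X * D).trace.re = 0) : D = 0 := by
  have hP := hX.posSemidef.conjTranspose_mul_mul_same D
  rw [hD.eq] at hP
  have h1 : (D * X * D).trace = 0 := by
    refine Complex.ext h0 ?_
    exact ((Complex.le_def.1 hP.trace_nonneg).2).symm
  have h2 : D * X * D = 0 := hP.trace_eq_zero_iff.1 h1
  ext i j
  by_contra hne
  have hv : D *ᵥ Pi.single j 1 ≠ 0 := by
    -- `D *ᵥ Pi.single j 1` is column `j` of `D`, nonzero because of the entry `D i j`. The form of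
    -- `X` at this vector is a diagonal entry of `D * X * D = 0`, against positive definiteness.
    intro hc
    exact hne (by simpa using congrFun hc i)
  have h3 := hX.dotProduct_mulVec_pos hv
  have h4 : star (D *ᵥ Pi.single j 1) ⬝ᵥ X *ᵥ (D *ᵥ Pi.single j 1) = 0 := by
    rw [Matrix.star_mulVec, hD.eq, ← Matrix.dotProduct_mulVec, Matrix.mulVec_mulVec,
      Matrix.mulVec_mulVec, h2]
    simp
  exact h3.ne' h4

/-- The gap in the tangent inequality for the trace of the inverse. -/
theorem trace_inv_sub_tangent {X Y : Matrix ι ι ℂ} (hX : IsUnit X.det) (hY : IsUnit Y.det) :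
    X⁻¹.trace = Y⁻¹.trace - (Y⁻¹ * Y⁻¹ * (X - Y)).trace
      + ((X⁻¹ - Y⁻¹) * X * (X⁻¹ - Y⁻¹)).trace := by
  -- The remainder expands to `X⁻¹ - 2 Y⁻¹ + Y⁻¹ X Y⁻¹`, whose last term has the trace of `Y⁻² X`.
  have e1 : (X⁻¹ - Y⁻¹) * X * (X⁻¹ - Y⁻¹) = X⁻¹ - Y⁻¹ - Y⁻¹ + Y⁻¹ * (X * Y⁻¹) := by
    have a : X⁻¹ * X = 1 := Matrix.nonsing_inv_mul _ hX
    have b : X * X⁻¹ = 1 := Matrix.mul_nonsing_inv _ hX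
    rw [sub_mul, a, sub_mul, one_mul, mul_sub, mul_assoc Y⁻¹ X X⁻¹, b, mul_one, mul_assoc]
    abel
  have e2 : (Y⁻¹ * (X * Y⁻¹)).trace = (Y⁻¹ * Y⁻¹ * X).trace := by
    rw [← Matrix.mul_assoc, Matrix.trace_mul_comm, Matrix.mul_assoc]
  have e3 : (Y⁻¹ * Y⁻¹ * Y).trace = Y⁻¹.trace := by
    rw [Matrix.mul_assoc, Matrix.nonsing_inv_mul _ hY, Matrix.mul_one]
  rw [e1, mul_sub, Matrix.trace_sub, e3, Matrix.trace_add, e2, Matrix.trace_sub,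
    Matrix.trace_sub]
  ring

/-- `U Diag(d) Uᴴ`. -/
def specMat (U : Matrix ι ι ℂ) (d : ι → ℝ) : Matrix ι ι ℂ :=
  U * Matrix.diagonal (fun k => (d k : ℂ)) * Uᴴ

variable {U : Matrix ι ι ℂ}

theorem specMat_add_smul (c : ℝ) (d e : ι → ℝ) :
    specMat U d + (c : ℂ) • specMat U e = specMat U (fun k => d k + c * e k) := by
  unfold specMat
  rw [← Matrix.smul_mul, ← Matrix.mul_smul, ← Matrix.diagonal_smul, ← Matrix.add_mul,
    ← Matrix.mul_add, Matrix.diagonal_add]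
  congr 3
  ext k
  simp

theorem specMat_mul (hU : U ∈ Matrix.unitaryGroup ι ℂ) (d e : ι → ℝ) :
    specMat U d * specMat U e = specMat U (fun k => d k * e k) := by
  have h : Uᴴ * U = 1 := Matrix.mem_unitaryGroup_iff'.1 hU
  unfold specMat
  calc _ = U * Matrix.diagonal (fun k => (d k : ℂ)) * (Uᴴ * U) *
        Matrix.diagonal (fun k => (e k : ℂ)) * Uᴴ := by simp only [Matrix.mul_assoc]
    _ = _ := by
      rw [h, Matrix.mul_one, Matrix.mul_assoc U, Matrix.diagonal_mul_diagonal]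
      simp

theorem specMat_inv (hU : U ∈ Matrix.unitaryGroup ι ℂ) {d : ι → ℝ} (hd : ∀ k, d k ≠ 0) :
    (specMat U d)⁻¹ = specMat U (fun k => (d k)⁻¹) := by
  apply Matrix.inv_eq_right_inv
  rw [specMat_mul hU]
  have h : U * Uᴴ = 1 := Matrix.mem_unitaryGroup_iff.1 hU
  have h2 : (fun k => d k * (d k)⁻¹) = fun _ => 1 := funext fun k => mul_inv_cancel₀ (hd k)
  rw [h2]
  simp [specMat, h]

theorem specMat_posDef (hU : U ∈ Matrix.unitaryGroup ι ℂ) {d : ι → ℝ} (hd : ∀ k, 0 < d k) :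
    (specMat U d).PosDef := by
  unfold specMat
  refine Matrix.PosDef.mul_mul_conjTranspose_same (Matrix.PosDef.diagonal ?_) ?_
  · intro k
    exact_mod_cast hd k
  · have h : U * Uᴴ = 1 := Matrix.mem_unitaryGroup_iff.1 hU
    intro x y hxy
    have := congrArg (fun v => v ᵥ* Uᴴ) hxy
    simpa [Matrix.vecMul_vecMul, h] using this

/-- A functional diagonal in the basis `U` ignores the off-diagonal entries of `Uᴴ Q U`; this is
what reduces the tangent term to a sum over modes. -/
theorem trace_specMat_mul_re (d : ι → ℝ) (Q : Matrix ι ι ℂ) :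
    (specMat U d * Q).trace.re = ∑ k, d k * ((Uᴴ * Q * U) k k).re := by
  have h : (specMat U d * Q).trace
      = (Matrix.diagonal (fun k => (d k : ℂ)) * (Uᴴ * Q * U)).trace := by
    unfold specMat
    rw [Matrix.mul_assoc, Matrix.mul_assoc, Matrix.trace_mul_comm]
    simp only [Matrix.mul_assoc]
  rw [h, Matrix.trace, Complex.re_sum]
  simp [Matrix.diag, Matrix.diagonal_mul]

theorem conjTranspose_mul_specMat_mul (hU : U ∈ Matrix.unitaryGroup ι ℂ) (d : ι → ℝ) :
    Uᴴ * specMat U d * U = Matrix.diagonal (fun k => (d k : ℂ)) := by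
  have h : Uᴴ * U = 1 := Matrix.mem_unitaryGroup_iff'.1 hU
  unfold specMat
  calc _ = (Uᴴ * U) * Matrix.diagonal (fun k => (d k : ℂ)) * (Uᴴ * U) := by
        simp only [Matrix.mul_assoc]
    _ = _ := by rw [h, Matrix.one_mul, Matrix.mul_one]

theorem pos_of_specMat_posDef (hU : U ∈ Matrix.unitaryGroup ι ℂ) {d : ι → ℝ}
    (h : (specMat U d).PosDef) (k : ι) : 0 < d k := by
  have h1 : (Matrix.diagonal (fun k => (d k : ℂ))).PosDef := by
    rw [← conjTranspose_mul_specMat_mul hU d]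
    refine h.conjTranspose_mul_mul_same ?_
    have h : Uᴴ * U = 1 := Matrix.mem_unitaryGroup_iff'.1 hU
    intro x y hxy
    have := congrArg (fun v => Uᴴ *ᵥ v) hxy
    simpa [Matrix.mulVec_mulVec, h] using this
  exact_mod_cast Matrix.posDef_diagonal_iff.1 h1 k

theorem nonneg_of_specMat_posSemidef (hU : U ∈ Matrix.unitaryGroup ι ℂ) {d : ι → ℝ}
    (h : (specMat U d).PosSemidef) (k : ι) : 0 ≤ d k := by
  have h1 : (Matrix.diagonal (fun k => (d k : ℂ))).PosSemidef := by
    rw [← conjTranspose_mul_specMat_mul hU d]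
    exact h.conjTranspose_mul_mul_same U
  exact_mod_cast Matrix.posSemidef_diagonal_iff.1 h1 k

/-- Error sum of a training Gram matrix `Q` against that of `U Diag(x) Uᴴ`. -/
theorem errorSum_gap {κ : Type*} [Fintype κ] (hU : U ∈ Matrix.unitaryGroup ι ℂ) {t x : ι → ℝ}
    (ht : ∀ k, 0 < t k) (hx : ∀ k, 0 ≤ x k) {σ α : κ → ℝ}
    (hα : ∀ n, 0 ≤ α n) {Q : Matrix ι ι ℂ} (hQ : Q.PosSemidef) :
    ∑ n, σ n * (((specMat U t)⁻¹ + (α n : ℂ) • Q)⁻¹).trace.re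
      = ∑ n, σ n * (((specMat U t)⁻¹ + (α n : ℂ) • specMat U x)⁻¹).trace.re
        + (∑ k, (∑ n, α n * σ n * t k ^ 2 / (1 + α n * t k * x k) ^ 2) * x k
          - ∑ k, (∑ n, α n * σ n * t k ^ 2 / (1 + α n * t k * x k) ^ 2) * ((Uᴴ * Q * U) k k).re)
        + ∑ n, σ n * ((((specMat U t)⁻¹ + (α n : ℂ) • Q)⁻¹
            - ((specMat U t)⁻¹ + (α n : ℂ) • specMat U x)⁻¹)
          * ((specMat U t)⁻¹ + (α n : ℂ) • Q)
          * (((specMat U t)⁻¹ + (α n : ℂ) • Q)⁻¹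
            - ((specMat U t)⁻¹ + (α n : ℂ) • specMat U x)⁻¹)).trace.re := by
  have hW : ((specMat U t)⁻¹).PosDef := (specMat_posDef hU ht).inv
  have hterm : ∀ n, (((specMat U t)⁻¹ + (α n : ℂ) • Q)⁻¹).trace.re
      = (((specMat U t)⁻¹ + (α n : ℂ) • specMat U x)⁻¹).trace.re
        + (∑ k, α n * t k ^ 2 / (1 + α n * t k * x k) ^ 2 * x k
          - ∑ k, α n * t k ^ 2 / (1 + α n * t k * x k) ^ 2 * ((Uᴴ * Q * U) k k).re)
        + ((((specMat U t)⁻¹ + (α n : ℂ) • Q)⁻¹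
            - ((specMat U t)⁻¹ + (α n : ℂ) • specMat U x)⁻¹)
          * ((specMat U t)⁻¹ + (α n : ℂ) • Q)
          * (((specMat U t)⁻¹ + (α n : ℂ) • Q)⁻¹
            - ((specMat U t)⁻¹ + (α n : ℂ) • specMat U x)⁻¹)).trace.re := by
    intro n
    have hX : ((specMat U t)⁻¹ + (α n : ℂ) • Q).PosDef :=
      hW.add_posSemidef (hQ.smul (by exact_mod_cast hα n))
    have hpos : ∀ k, 0 < (t k)⁻¹ + α n * x k := fun k => by
      have h1 := ht k
      have h2 := hx k
      have h3 := hα n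
      positivity
    have hYeq : (specMat U t)⁻¹ + (α n : ℂ) • specMat U x
        = specMat U (fun k => (t k)⁻¹ + α n * x k) := by
      rw [specMat_inv hU fun k => (ht k).ne', specMat_add_smul]
    have hY : ((specMat U t)⁻¹ + (α n : ℂ) • specMat U x).PosDef := by
      rw [hYeq]
      exact specMat_posDef hU hpos
    -- These are the eigenvalues of the tangent weight `Y⁻²`. Multiplied by `α n * σ n` and summed
    -- over `n`, they become the water levels at power `x k`.
    have hinv : ((specMat U t)⁻¹ + (α n : ℂ) • specMat U x)⁻¹
        * ((specMat U t)⁻¹ + (α n : ℂ) • specMat U x)⁻¹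
        = specMat U (fun k => t k ^ 2 / (1 + α n * t k * x k) ^ 2) := by
      rw [hYeq, specMat_inv hU fun k => (hpos k).ne', specMat_mul hU]
      congr 1
      funext k
      have h1 := ht k
      have h2 := hx k
      have h3 := hα n
      have h4 := hpos k
      have h5 : (t k)⁻¹ + α n * x k = (1 + α n * t k * x k) / t k := by field_simp
      rw [h5]
      field_simp
    have hdiff : (specMat U t)⁻¹ + (α n : ℂ) • Q - ((specMat U t)⁻¹ + (α n : ℂ) • specMat U x)
        = (α n : ℂ) • (Q - specMat U x) := by
      rw [smul_sub]
      abel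
    have htr : (specMat U (fun k => t k ^ 2 / (1 + α n * t k * x k) ^ 2)
          * ((α n : ℂ) • (Q - specMat U x))).trace.re
        = ∑ k, α n * t k ^ 2 / (1 + α n * t k * x k) ^ 2 * ((Uᴴ * Q * U) k k).re
          - ∑ k, α n * t k ^ 2 / (1 + α n * t k * x k) ^ 2 * x k := by
      rw [Matrix.mul_smul, Matrix.trace_smul, smul_eq_mul, Complex.re_ofReal_mul,
        Matrix.mul_sub, Matrix.trace_sub, Complex.sub_re, trace_specMat_mul_re,
        trace_specMat_mul_re, conjTranspose_mul_specMat_mul hU, mul_sub, Finset.mul_sum,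
        Finset.mul_sum]
      congr 1
      · exact Finset.sum_congr rfl fun k _ => by ring
      · exact Finset.sum_congr rfl fun k _ => by
          rw [Matrix.diagonal_apply_eq, Complex.ofReal_re]; ring
    have h := trace_inv_sub_tangent ((Matrix.isUnit_iff_isUnit_det _).1 hX.isUnit)
      ((Matrix.isUnit_iff_isUnit_det _).1 hY.isUnit)
    rw [hinv, hdiff] at h
    have h' := congrArg Complex.re h
    rw [Complex.add_re, Complex.sub_re, htr] at h'
    linarith
  have hswap : ∀ c : ι → ℝ,
      ∑ k, (∑ n, α n * σ n * t k ^ 2 / (1 + α n * t k * x k) ^ 2) * c k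
      = ∑ n, σ n * ∑ k, α n * t k ^ 2 / (1 + α n * t k * x k) ^ 2 * c k := by
    intro c
    simp only [Finset.sum_mul, Finset.mul_sum]
    rw [Finset.sum_comm]
    exact Finset.sum_congr rfl fun n _ => Finset.sum_congr rfl fun k _ => by ring
  rw [hswap x, hswap fun k => ((Uᴴ * Q * U) k k).re, ← Finset.sum_sub_distrib,
    ← Finset.sum_add_distrib, ← Finset.sum_add_distrib]
  refine Finset.sum_congr rfl fun n _ => ?_
  rw [hterm n]
  ring

/-- The assumption `hle` says that the tangent term does not favour `Q`, and the remainders are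
nonnegative. In case of a tie every remainder vanishes, and a single index with `σ n` and `α n`
positive already forces `Q = specMat U x`. -/
theorem errorSum_gap_nonneg {κ : Type*} [Fintype κ] (hU : U ∈ Matrix.unitaryGroup ι ℂ)
    {t x : ι → ℝ} (ht : ∀ k, 0 < t k) (hx : ∀ k, 0 ≤ x k) {σ α : κ → ℝ} (hσ : ∀ n, 0 ≤ σ n)
    (hα : ∀ n, 0 ≤ α n) {Q : Matrix ι ι ℂ} (hQ : Q.PosSemidef)
    (hle : ∑ k, (∑ n, α n * σ n * t k ^ 2 / (1 + α n * t k * x k) ^ 2) * ((Uᴴ * Q * U) k k).re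
      ≤ ∑ k, (∑ n, α n * σ n * t k ^ 2 / (1 + α n * t k * x k) ^ 2) * x k) :
    ∑ n, σ n * (((specMat U t)⁻¹ + (α n : ℂ) • specMat U x)⁻¹).trace.re
      ≤ ∑ n, σ n * (((specMat U t)⁻¹ + (α n : ℂ) • Q)⁻¹).trace.re ∧
    ((∃ n, 0 < σ n ∧ 0 < α n) →
      ∑ n, σ n * (((specMat U t)⁻¹ + (α n : ℂ) • Q)⁻¹).trace.re
        ≤ ∑ n, σ n * (((specMat U t)⁻¹ + (α n : ℂ) • specMat U x)⁻¹).trace.re →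
      Q = specMat U x) := by
  have hW : ((specMat U t)⁻¹).PosDef := (specMat_posDef hU ht).inv
  have hX : ∀ n, ((specMat U t)⁻¹ + (α n : ℂ) • Q).PosDef := fun n =>
    hW.add_posSemidef (hQ.smul (by exact_mod_cast hα n))
  have hx' : (specMat U x).PosSemidef := by
    refine Matrix.PosSemidef.mul_mul_conjTranspose_same (Matrix.PosSemidef.diagonal ?_) U
    intro k
    simpa using hx k
  have hY : ∀ n, ((specMat U t)⁻¹ + (α n : ℂ) • specMat U x).PosDef := fun n =>
    hW.add_posSemidef (hx'.smul (by exact_mod_cast hα n))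
  have hD : ∀ n, (((specMat U t)⁻¹ + (α n : ℂ) • Q)⁻¹
      - ((specMat U t)⁻¹ + (α n : ℂ) • specMat U x)⁻¹).IsHermitian := fun n =>
    (hX n).inv.isHermitian.sub (hY n).inv.isHermitian
  have hgap := errorSum_gap (σ := σ) hU ht hx hα hQ
  have hnn : ∀ n, 0 ≤ σ n * ((((specMat U t)⁻¹ + (α n : ℂ) • Q)⁻¹
            - ((specMat U t)⁻¹ + (α n : ℂ) • specMat U x)⁻¹)
          * ((specMat U t)⁻¹ + (α n : ℂ) • Q)
          * (((specMat U t)⁻¹ + (α n : ℂ) • Q)⁻¹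
            - ((specMat U t)⁻¹ + (α n : ℂ) • specMat U x)⁻¹)).trace.re := fun n =>
    mul_nonneg (hσ n) (trace_re_mul_mul_nonneg (hX n) (hD n))
  have hsum := Finset.sum_nonneg fun n (_ : n ∈ Finset.univ) => hnn n
  refine ⟨by linarith, ?_⟩
  rintro ⟨n, hσn, hαn⟩ hge
  have hz := (Finset.sum_eq_zero_iff_of_nonneg fun n _ => hnn n).1
    (le_antisymm (by linarith) hsum) n (Finset.mem_univ n)
  have hinv := sub_eq_zero.1 (eq_zero_of_trace_re_mul_mul_eq_zero (hX n) (hD n)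
    ((mul_eq_zero.1 hz).resolve_left hσn.ne'))
  have hXY := Matrix.inv_inj hinv ((Matrix.isUnit_iff_isUnit_det _).1 (hX n).isUnit)
  exact smul_right_injective _ (by exact_mod_cast hαn.ne' : (α n : ℂ) ≠ 0)
    (add_left_cancel hXY)

end Trace

/-! ### Factoring a matrix with orthogonal rows -/

section Rows

variable {ι : Type*} [Fintype ι] [DecidableEq ι] {L : ℕ}

/-- A matrix with orthogonal rows of norms `s` factors as `Diag(s) Vᴴ` with `V` an isometry. -/
theorem exists_isometry_of_mul_conjTranspose_eq_diagonal (hL : Fintype.card ι ≤ L)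
    (A : Matrix ι (Fin L) ℂ) (s : ι → ℝ)
    (hA : A * Aᴴ = Matrix.diagonal (fun k => ((s k ^ 2 : ℝ) : ℂ))) :
    ∃ V : Matrix (Fin L) ι ℂ, Vᴴ * V = 1 ∧ A = Matrix.diagonal (fun k => (s k : ℂ)) * Vᴴ := by
  obtain ⟨e⟩ : Nonempty (ι ↪ Fin L) :=
    Function.Embedding.nonempty_of_card_le (by simpa using hL)
  -- The rows are conjugated because they are to become, after normalization, columns of `V`, while
  -- `A` involves `Vᴴ`.
  let a : ι → EuclideanSpace ℂ (Fin L) := fun k => WithLp.toLp 2 fun l => star (A k l)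
  have ha : ∀ j k, inner ℂ (a j) (a k) = if j = k then ((s k ^ 2 : ℝ) : ℂ) else 0 := by
    intro j k
    have h := congrFun (congrFun hA j) k
    rw [Matrix.mul_apply, Matrix.diagonal_apply] at h
    rw [PiLp.inner_apply]
    simp only [a, RCLike.inner_apply]
    simp only [Matrix.conjTranspose_apply] at h
    have h2 : ∑ l, star (A k l) * (starRingEnd ℂ) (star (A j l)) = ∑ l, A j l * star (A k l) :=
      Finset.sum_congr rfl fun l _ => by simp [mul_comm]
    rw [h2, h]
    split_ifs with hjk
    · rw [hjk]
    · rfl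
  -- Only rows with `s k ≠ 0` can be normalized. They form an orthonormal family, and its extension
  -- to a basis of `ℂ^L` supplies the columns of `V` at the zero loadings, where the rows of `A`
  -- vanish.
  let v : Fin L → EuclideanSpace ℂ (Fin L) :=
    Function.extend e (fun k => ((s k : ℂ))⁻¹ • a k) 0
  have hv : ∀ k, v (e k) = ((s k : ℂ))⁻¹ • a k := fun k => e.injective.extend_apply _ _ k
  have hon : Orthonormal ℂ (Set.domRestrict (e '' {k | s k ≠ 0}) v) := by
    rw [orthonormal_iff_ite]
    rintro ⟨x, hx⟩ ⟨y, hy⟩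
    obtain ⟨j, hj, rfl⟩ := (Set.mem_image _ _ _).1 hx
    obtain ⟨k, hk, rfl⟩ := (Set.mem_image _ _ _).1 hy
    simp only [Set.domRestrict_apply, hv, inner_smul_left, inner_smul_right, ha,
      Subtype.mk.injEq, e.injective.eq_iff]
    split_ifs with hjk
    · subst hjk
      have : (s j : ℂ) ≠ 0 := by exact_mod_cast hj
      simp only [map_inv₀, Complex.conj_ofReal, Complex.ofReal_pow]
      field_simp
    · simp
  obtain ⟨b, hb⟩ := hon.exists_orthonormalBasis_extension_of_card_eq (by simp)
  refine ⟨Matrix.of fun l k => b (e k) l, ?_, ?_⟩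
  · ext j k
    have h := orthonormal_iff_ite.1 b.orthonormal (e j) (e k)
    rw [PiLp.inner_apply] at h
    simp only [RCLike.inner_apply, e.injective.eq_iff] at h
    rw [Matrix.mul_apply, Matrix.one_apply, ← h]
    exact Finset.sum_congr rfl fun l _ => by simp [mul_comm]
  · ext k l
    rw [Matrix.diagonal_mul, Matrix.conjTranspose_apply, Matrix.of_apply]
    by_cases hk : s k = 0
    · have h0 := ha k k
      rw [if_pos rfl, hk] at h0
      have h1 : a k = 0 := by
        rw [← inner_self_eq_zero (𝕜 := ℂ), h0]
        simp
      have h2 : star (A k l) = 0 := congrArg (fun w : EuclideanSpace ℂ (Fin L) => w l) h1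
      rw [hk, star_eq_zero.1 h2]
      simp
    · have h1 : b (e k) = ((s k : ℂ))⁻¹ • a k := (hb (e k) ⟨k, hk, rfl⟩).trans (hv k)
      have hk' : (s k : ℂ) ≠ 0 := by exact_mod_cast hk
      rw [h1]
      simp [a, hk']

end Rows

end MAC

namespace MAC

/-! ### Gram matrices of training sequences -/

section Training

theorem conj_eq_transpose_conjTranspose {m n : Type*} (A : Matrix m n ℂ) : conj A = Aᴴᵀ := rfl

theorem conj_mul_transpose {ι κ L : Type*} [Fintype L] (A : Matrix ι L ℂ) (B : Matrix κ L ℂ) :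
    conj A * Bᵀ = (B * Aᴴ)ᵀ := by
  rw [conj_eq_transpose_conjTranspose, ← Matrix.transpose_mul]

theorem conj_mul_transpose_posSemidef {ι L : Type*} [Finite ι] [Fintype L] (A : Matrix ι L ℂ) :
    (conj A * Aᵀ).PosSemidef := by
  rw [conj_mul_transpose]
  exact (Matrix.posSemidef_self_mul_conjTranspose A).transpose

/-- Transposition turns the condition into one on `S Sᴴ`, which says that `Uᵀ S` has orthogonal rows
of norms `|s k|`. The row factorization then gives `V`, and multiplication by `conj U` undoes the
rotation. -/
theorem conj_mul_transpose_eq_specMat_iff {ι : Type*} [Fintype ι] [DecidableEq ι] {L : ℕ}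
    (hL : Fintype.card ι ≤ L) {U : Matrix ι ι ℂ} (hU : U ∈ Matrix.unitaryGroup ι ℂ) (s : ι → ℝ)
    (S : Matrix ι (Fin L) ℂ) :
    conj S * Sᵀ = specMat U (fun k => s k ^ 2) ↔
      ∃ V : Matrix (Fin L) ι ℂ, Vᴴ * V = 1 ∧
        S = conj U * Matrix.diagonal (fun k => (s k : ℂ)) * Vᴴ := by
  have hUU : conj U * Uᵀ = 1 := by
    rw [conj_mul_transpose, show U * Uᴴ = 1 from Matrix.mem_unitaryGroup_iff.1 hU,
      Matrix.transpose_one]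
  have hUU' : Uᵀ * conj U = 1 := mul_eq_one_comm.1 hUU
  have hct : (conj U)ᴴ = Uᵀ := by
    ext i j
    simp [conj]
  have hct' : Uᵀᴴ = conj U := rfl
  have hspec : (specMat U (fun k => s k ^ 2))ᵀ
      = conj U * Matrix.diagonal (fun k => ((s k ^ 2 : ℝ) : ℂ)) * Uᵀ := by
    unfold specMat
    rw [Matrix.transpose_mul, Matrix.transpose_mul, Matrix.diagonal_transpose,
      ← Matrix.mul_assoc, conj_eq_transpose_conjTranspose]
  rw [conj_mul_transpose, ← Matrix.transpose_inj, Matrix.transpose_transpose, hspec]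
  constructor
  · intro h
    obtain ⟨V, hV, hA⟩ := exists_isometry_of_mul_conjTranspose_eq_diagonal hL (Uᵀ * S) s (by
      calc Uᵀ * S * (Uᵀ * S)ᴴ = Uᵀ * (S * Sᴴ) * conj U := by
            rw [Matrix.conjTranspose_mul, hct']
            simp only [Matrix.mul_assoc]
        _ = (Uᵀ * conj U) * Matrix.diagonal (fun k => ((s k ^ 2 : ℝ) : ℂ))
              * (Uᵀ * conj U) := by
            rw [h]
            simp only [Matrix.mul_assoc]
        _ = _ := by rw [hUU', Matrix.one_mul, Matrix.mul_one])
    refine ⟨V, hV, ?_⟩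
    rw [Matrix.mul_assoc, ← hA, ← Matrix.mul_assoc, hUU, Matrix.one_mul]
  · rintro ⟨V, hV, rfl⟩
    rw [Matrix.conjTranspose_mul, Matrix.conjTranspose_mul, hct, Matrix.conjTranspose_conjTranspose,
      Matrix.diagonal_conjTranspose]
    calc _ = conj U * (Matrix.diagonal (fun k => (s k : ℂ)) * (Vᴴ * V) *
          Matrix.diagonal (star fun k => (s k : ℂ))) * Uᵀ := by simp only [Matrix.mul_assoc]
      _ = _ := by
        rw [hV, Matrix.mul_one, Matrix.diagonal_mul_diagonal]
        congr 3
        ext k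
        simp [sq]

variable {N₁ N₂ L : ℕ}

theorem fromBlocks_mem_unitaryGroup {U₁ : Matrix (Fin N₁) (Fin N₁) ℂ}
    {U₂ : Matrix (Fin N₂) (Fin N₂) ℂ} (h₁ : U₁ ∈ Matrix.unitaryGroup (Fin N₁) ℂ)
    (h₂ : U₂ ∈ Matrix.unitaryGroup (Fin N₂) ℂ) :
    Matrix.fromBlocks U₁ 0 0 U₂ ∈ Matrix.unitaryGroup (Fin N₁ ⊕ Fin N₂) ℂ := by
  have h₁' : U₁ * U₁ᴴ = 1 := Matrix.mem_unitaryGroup_iff.1 h₁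
  have h₂' : U₂ * U₂ᴴ = 1 := Matrix.mem_unitaryGroup_iff.1 h₂
  rw [Matrix.mem_unitaryGroup_iff, Matrix.star_eq_conjTranspose, Matrix.fromBlocks_conjTranspose,
    Matrix.fromBlocks_multiply]
  simp [h₁', h₂']

theorem diagonal_sumElim (d₁ : Fin N₁ → ℝ) (d₂ : Fin N₂ → ℝ) :
    Matrix.diagonal (fun k => ((Sum.elim d₁ d₂ k : ℝ) : ℂ))
      = Matrix.fromBlocks (Matrix.diagonal fun k => (d₁ k : ℂ)) 0 0
        (Matrix.diagonal fun k => (d₂ k : ℂ)) := by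
  rw [Matrix.fromBlocks_diagonal]
  congr 1
  ext k
  cases k <;> rfl

theorem specMat_fromBlocks (U₁ : Matrix (Fin N₁) (Fin N₁) ℂ) (U₂ : Matrix (Fin N₂) (Fin N₂) ℂ)
    (d₁ : Fin N₁ → ℝ) (d₂ : Fin N₂ → ℝ) :
    specMat (Matrix.fromBlocks U₁ 0 0 U₂) (Sum.elim d₁ d₂)
      = Matrix.fromBlocks (specMat U₁ d₁) 0 0 (specMat U₂ d₂) := by
  unfold specMat
  rw [diagonal_sumElim, Matrix.fromBlocks_conjTranspose, Matrix.fromBlocks_multiply,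
    Matrix.fromBlocks_multiply]
  simp

theorem gram_eq_fromBlocks (S₁ : Matrix (Fin N₁) (Fin L) ℂ) (S₂ : Matrix (Fin N₂) (Fin L) ℂ) :
    gram S₁ S₂ = Matrix.fromBlocks (conj S₁ * S₁ᵀ) (conj S₁ * S₂ᵀ) (conj S₂ * S₁ᵀ)
      (conj S₂ * S₂ᵀ) := by
  have h : conj (Matrix.fromRows S₁ S₂) = Matrix.fromRows (conj S₁) (conj S₂) := by
    ext (i | i) j <;> rfl
  rw [gram, h, Matrix.transpose_fromRows, Matrix.fromRows_mul_fromCols]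

theorem feasible_iff {τ₁ τ₂ : ℝ} {S₁ : Matrix (Fin N₁) (Fin L) ℂ}
    {S₂ : Matrix (Fin N₂) (Fin L) ℂ} :
    Feasible τ₁ τ₂ S₁ S₂ ↔
      (conj S₁ * S₁ᵀ).trace.re ≤ τ₁ ∧ (conj S₂ * S₂ᵀ).trace.re ≤ τ₂ := by
  simp [Feasible, gram_eq_fromBlocks, Matrix.fromBlocks_multiply, Matrix.trace, Fintype.sum_sum_type]

/-- Sources of the stated form, with jointly orthonormal right factors, are exactly those whose
Gram matrix is diagonalized by the transmit eigenvectors with the squared loadings. -/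
theorem gram_eq_specMat_iff (hL : N₁ + N₂ ≤ L) {U₁ : Matrix (Fin N₁) (Fin N₁) ℂ}
    {U₂ : Matrix (Fin N₂) (Fin N₂) ℂ} (h₁ : U₁ ∈ Matrix.unitaryGroup (Fin N₁) ℂ)
    (h₂ : U₂ ∈ Matrix.unitaryGroup (Fin N₂) ℂ) (s₁ : Fin N₁ → ℝ) (s₂ : Fin N₂ → ℝ)
    (S₁ : Matrix (Fin N₁) (Fin L) ℂ) (S₂ : Matrix (Fin N₂) (Fin L) ℂ) :
    gram S₁ S₂ = specMat (Matrix.fromBlocks U₁ 0 0 U₂) (fun k => Sum.elim s₁ s₂ k ^ 2) ↔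
      ∃ (V₁ : Matrix (Fin L) (Fin N₁) ℂ) (V₂ : Matrix (Fin L) (Fin N₂) ℂ),
        V₁ᴴ * V₁ = 1 ∧ V₂ᴴ * V₂ = 1 ∧ V₁ᴴ * V₂ = 0 ∧ HasForm U₁ s₁ V₁ S₁ ∧ HasForm U₂ s₂ V₂ S₂ := by
  have hcU : conj (Matrix.fromBlocks U₁ 0 0 U₂) = Matrix.fromBlocks (conj U₁) 0 0 (conj U₂) := by
    simp [conj, Matrix.fromBlocks_map]
  have hform : ∀ (V₁ : Matrix (Fin L) (Fin N₁) ℂ) (V₂ : Matrix (Fin L) (Fin N₂) ℂ),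
      Matrix.fromRows S₁ S₂ = conj (Matrix.fromBlocks U₁ 0 0 U₂)
        * Matrix.diagonal (fun k => ((Sum.elim s₁ s₂ k : ℝ) : ℂ)) * (Matrix.fromCols V₁ V₂)ᴴ ↔
      HasForm U₁ s₁ V₁ S₁ ∧ HasForm U₂ s₂ V₂ S₂ := by
    intro V₁ V₂
    rw [hcU, diagonal_sumElim, Matrix.fromBlocks_multiply,
      Matrix.conjTranspose_fromCols_eq_fromRows_conjTranspose, Matrix.fromBlocks_mul_fromRows]
    simp only [Matrix.zero_mul, Matrix.mul_zero, add_zero, zero_add]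
    exact Matrix.fromRows_inj.eq_iff
  have horth : ∀ (V₁ : Matrix (Fin L) (Fin N₁) ℂ) (V₂ : Matrix (Fin L) (Fin N₂) ℂ),
      (Matrix.fromCols V₁ V₂)ᴴ * Matrix.fromCols V₁ V₂ = 1 ↔
        V₁ᴴ * V₁ = 1 ∧ V₂ᴴ * V₂ = 1 ∧ V₁ᴴ * V₂ = 0 := by
    intro V₁ V₂
    rw [Matrix.conjTranspose_fromCols_eq_fromRows_conjTranspose, Matrix.fromRows_mul_fromCols,
      ← Matrix.fromBlocks_one, Matrix.fromBlocks_inj]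
    constructor
    · rintro ⟨a, b, -, d⟩
      exact ⟨a, d, b⟩
    · rintro ⟨a, d, b⟩
      refine ⟨a, b, ?_, d⟩
      have := congrArg Matrix.conjTranspose b
      simpa using this
  rw [gram, conj_mul_transpose_eq_specMat_iff (by simpa using hL)
    (fromBlocks_mem_unitaryGroup h₁ h₂)]
  constructor
  · rintro ⟨V, hV, hS⟩
    -- The column blocks of the joint isometry are the two right factors; `Vᴴ V = 1` contains their
    -- mutual orthogonality.
    rw [← Matrix.fromCols_toCols V] at hV hS
    obtain ⟨a, b, c⟩ := (horth _ _).1 hV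
    obtain ⟨d, e⟩ := (hform _ _).1 hS
    exact ⟨_, _, a, b, c, d, e⟩
  · rintro ⟨V₁, V₂, a, b, c, d, e⟩
    exact ⟨Matrix.fromCols V₁ V₂, (horth _ _).2 ⟨a, b, c⟩, (hform _ _).2 ⟨d, e⟩⟩

/-! ### Optimality of the water-filling Gram matrix -/

variable {M N : ℕ} {q : ℝ} {sigmaR deltaR : Fin M → ℝ}

/-- Complementary slackness: the marginal value of a feasible Gram matrix is largest at the
water-filling loading. -/
theorem IsWaterFilling.sum_level_mul_le (hσ : ∀ n, 0 ≤ sigmaR n)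
    (hα : ∀ n, 0 ≤ alpha q sigmaR deltaR n) {t : Fin N → ℝ} {τ lam : ℝ} (hN : 0 < N)
    {s : Fin N → ℝ} (h : IsWaterFilling q sigmaR deltaR t τ lam s)
    {U : Matrix (Fin N) (Fin N) ℂ} (hU : U ∈ Matrix.unitaryGroup (Fin N) ℂ)
    {Q : Matrix (Fin N) (Fin N) ℂ} (hQ : Q.PosSemidef) (hτ : Q.trace.re ≤ τ) :
    ∑ m, level q sigmaR deltaR (t m) (s m) * ((Uᴴ * Q * U) m m).re
      ≤ ∑ m, level q sigmaR deltaR (t m) (s m) * s m ^ 2 := by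
  have hlam : 0 ≤ lam := by
    refine le_trans (Finset.sum_nonneg fun n _ => ?_) (h.level_le ⟨0, hN⟩)
    have h1 := hα n
    have h2 := hσ n
    positivity
  -- Modes without power contribute nothing, and all others have level `lam`.
  have hr : ∑ m, level q sigmaR deltaR (t m) (s m) * s m ^ 2 = lam * τ := by
    rw [← h.power, Finset.mul_sum]
    refine Finset.sum_congr rfl fun m _ => ?_
    rcases (h.nonneg m).eq_or_lt with h0 | h0
    · simp [← h0]
    · rw [h.active m h0]
  have htr : ∑ m, ((Uᴴ * Q * U) m m).re = Q.trace.re := by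
    have h1 : (Uᴴ * Q * U).trace = Q.trace := by
      rw [Matrix.trace_mul_comm, ← Matrix.mul_assoc,
        show U * Uᴴ = 1 from Matrix.mem_unitaryGroup_iff.1 hU, Matrix.one_mul]
    rw [← h1, Matrix.trace, Complex.re_sum]
    rfl
  rw [hr]
  calc _ ≤ ∑ m, lam * ((Uᴴ * Q * U) m m).re := by
        refine Finset.sum_le_sum fun m _ => mul_le_mul_of_nonneg_right (h.level_le m) ?_
        exact (Complex.le_def.1 ((hQ.conjTranspose_mul_mul_same U).diag_nonneg (i := m))).1
    _ = lam * Q.trace.re := by rw [← Finset.mul_sum, htr]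
    _ ≤ _ := mul_le_mul_of_nonneg_left hτ hlam

/-- A feasible training matrix does no better than the water-filling Gram matrix, and as well only
if it has that Gram matrix. -/
theorem mse_optimality (hN₁ : 0 < N₁) (hN₂ : 0 < N₂) {Z₁ U₁ : Matrix (Fin N₁) (Fin N₁) ℂ}
    {t₁ : Fin N₁ → ℝ} (hU₁ : IsEigendecomposition Z₁ U₁ t₁) (ht₁ : ∀ m, 0 < t₁ m)
    {Z₂ U₂ : Matrix (Fin N₂) (Fin N₂) ℂ} {t₂ : Fin N₂ → ℝ}
    (hU₂ : IsEigendecomposition Z₂ U₂ t₂) (ht₂ : ∀ m, 0 < t₂ m)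
    (hσ : ∀ n, 0 ≤ sigmaR n) (hα : ∀ n, 0 ≤ alpha q sigmaR deltaR n)
    (hpos : ∃ n, 0 < sigmaR n ∧ 0 < alpha q sigmaR deltaR n)
    {τ₁ τ₂ lam₁ lam₂ : ℝ} {s₁ : Fin N₁ → ℝ} {s₂ : Fin N₂ → ℝ}
    (hs₁ : IsWaterFilling q sigmaR deltaR t₁ τ₁ lam₁ s₁)
    (hs₂ : IsWaterFilling q sigmaR deltaR t₂ τ₂ lam₂ s₂)
    {S₁ T₁ : Matrix (Fin N₁) (Fin L) ℂ} {S₂ T₂ : Matrix (Fin N₂) (Fin L) ℂ}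
    (hS : gram S₁ S₂ = specMat (Matrix.fromBlocks U₁ 0 0 U₂) (fun k => Sum.elim s₁ s₂ k ^ 2))
    (hT : Feasible τ₁ τ₂ T₁ T₂) :
    mse Z₁ Z₂ q sigmaR deltaR S₁ S₂ ≤ mse Z₁ Z₂ q sigmaR deltaR T₁ T₂ ∧
    (mse Z₁ Z₂ q sigmaR deltaR T₁ T₂ ≤ mse Z₁ Z₂ q sigmaR deltaR S₁ S₂ →
      gram T₁ T₂ = gram S₁ S₂) := by
  have hZ : Matrix.fromBlocks Z₁ 0 0 Z₂
      = specMat (Matrix.fromBlocks U₁ 0 0 U₂) (Sum.elim t₁ t₂) := by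
    rw [specMat_fromBlocks, hU₁.2, hU₂.2]
    rfl
  have hdiag := feasible_iff.1 hT
  have hmain := errorSum_gap_nonneg (fromBlocks_mem_unitaryGroup hU₁.1 hU₂.1)
    (t := Sum.elim t₁ t₂) (x := fun k => Sum.elim s₁ s₂ k ^ 2)
    (by rintro (k | k); exacts [ht₁ k, ht₂ k]) (fun k => sq_nonneg _) hσ hα
    (conj_mul_transpose_posSemidef (Matrix.fromRows T₁ T₂)) (by
      -- With powers written as squared loadings, the tangent weights are the levels. Since `U` is
      -- block diagonal, the cross blocks of the Gram matrix do not enter, and the bound splits into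
      -- one for each source.
      change ∑ k, level q sigmaR deltaR (Sum.elim t₁ t₂ k) (Sum.elim s₁ s₂ k)
          * (((Matrix.fromBlocks U₁ 0 0 U₂)ᴴ * gram T₁ T₂ * Matrix.fromBlocks U₁ 0 0 U₂) k k).re
        ≤ ∑ k, level q sigmaR deltaR (Sum.elim t₁ t₂ k) (Sum.elim s₁ s₂ k)
          * Sum.elim s₁ s₂ k ^ 2
      rw [gram_eq_fromBlocks, Matrix.fromBlocks_conjTranspose, Matrix.fromBlocks_multiply,
        Matrix.fromBlocks_multiply, Fintype.sum_sum_type, Fintype.sum_sum_type]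
      simp only [Matrix.conjTranspose_zero, Matrix.zero_mul, Matrix.mul_zero, add_zero, zero_add,
        Sum.elim_inl, Sum.elim_inr, Matrix.fromBlocks_apply₁₁, Matrix.fromBlocks_apply₂₂]
      exact add_le_add
        (hs₁.sum_level_mul_le hσ hα hN₁ hU₁.1 (conj_mul_transpose_posSemidef T₁) hdiag.1)
        (hs₂.sum_level_mul_le hσ hα hN₂ hU₂.1 (conj_mul_transpose_posSemidef T₂) hdiag.2))
  rw [← hZ, ← hS] at hmain
  exact ⟨hmain.1, hmain.2 hpos⟩

theorem specMat_trace_re {U : Matrix (Fin N) (Fin N) ℂ} (hU : U ∈ Matrix.unitaryGroup (Fin N) ℂ)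
    (d : Fin N → ℝ) : (specMat U d).trace.re = ∑ m, d m := by
  have h : Uᴴ * U = 1 := Matrix.mem_unitaryGroup_iff'.1 hU
  have := trace_specMat_mul_re (U := U) d 1
  simpa [h] using this

/-- Comparison of blocks: the diagonal ones give the powers, the vanishing off-diagonal one gives
orthogonality. -/
theorem feasible_of_gram_eq {U₁ : Matrix (Fin N₁) (Fin N₁) ℂ}
    {U₂ : Matrix (Fin N₂) (Fin N₂) ℂ} (h₁ : U₁ ∈ Matrix.unitaryGroup (Fin N₁) ℂ)
    (h₂ : U₂ ∈ Matrix.unitaryGroup (Fin N₂) ℂ) {s₁ : Fin N₁ → ℝ} {s₂ : Fin N₂ → ℝ}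
    {S₁ : Matrix (Fin N₁) (Fin L) ℂ} {S₂ : Matrix (Fin N₂) (Fin L) ℂ}
    (hS : gram S₁ S₂ = specMat (Matrix.fromBlocks U₁ 0 0 U₂) (fun k => Sum.elim s₁ s₂ k ^ 2)) :
    Feasible (∑ m, s₁ m ^ 2) (∑ m, s₂ m ^ 2) S₁ S₂ ∧ conj S₁ * S₂ᵀ = 0 := by
  have he : (fun k => Sum.elim s₁ s₂ k ^ 2)
      = Sum.elim (fun m => s₁ m ^ 2) (fun m => s₂ m ^ 2) := by
    ext (k | k) <;> rfl
  rw [he, specMat_fromBlocks, gram_eq_fromBlocks, Matrix.fromBlocks_inj] at hS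
  obtain ⟨a, b, -, d⟩ := hS
  refine ⟨feasible_iff.2 ⟨?_, ?_⟩, b⟩
  · rw [a, specMat_trace_re h₁]
  · rw [d, specMat_trace_re h₂]

end Training

end MAC

/-! ### The main theorem -/

theorem theorem3 {M N₁ N₂ L : ℕ} (hN₁ : 0 < N₁) (hN₂ : 0 < N₂) (hL : N₁ + N₂ ≤ L)
    -- transmit covariances and their eigendecompositions
    (Z₁ U₁ : Matrix (Fin N₁) (Fin N₁) ℂ) (t₁ : Fin N₁ → ℝ)
    (hZ₁ : Z₁.PosDef) (hU₁ : MAC.IsEigendecomposition Z₁ U₁ t₁)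
    (Z₂ U₂ : Matrix (Fin N₂) (Fin N₂) ℂ) (t₂ : Fin N₂ → ℝ)
    (hZ₂ : Z₂.PosDef) (hU₂ : MAC.IsEigendecomposition Z₂ U₂ t₂)
    -- receive covariance and spatial disturbance covariance, with common eigenvectors
    (Zr Kr Ur : Matrix (Fin M) (Fin M) ℂ) (sigmaR deltaR : Fin M → ℝ)
    (hZr : Zr.PosSemidef) (hZr0 : Zr ≠ 0) (hKr : Kr.PosDef)
    (hZrU : MAC.IsEigendecomposition Zr Ur sigmaR)
    (hKrU : MAC.IsEigendecomposition Kr Ur deltaR)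
    -- temporal disturbance level and power budgets
    (q : ℝ) (hq : 0 < q) (τ₁ τ₂ : ℝ) (hτ₁ : 0 < τ₁) (hτ₂ : 0 < τ₂) :
    -- optimal training sequences exist
    (∃ (S₁ : Matrix (Fin N₁) (Fin L) ℂ) (S₂ : Matrix (Fin N₂) (Fin L) ℂ),
      MAC.IsOptimal Z₁ Z₂ q sigmaR deltaR τ₁ τ₂ S₁ S₂) ∧
    -- they are mutually orthogonal
    (∀ (S₁ : Matrix (Fin N₁) (Fin L) ℂ) (S₂ : Matrix (Fin N₂) (Fin L) ℂ),
      MAC.IsOptimal Z₁ Z₂ q sigmaR deltaR τ₁ τ₂ S₁ S₂ → MAC.conj S₁ * S₂ᵀ = 0) ∧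
    -- the water-filling problems determine the multipliers and the loadings
    (∃! p : ℝ × (Fin N₁ → ℝ), MAC.IsWaterFilling q sigmaR deltaR t₁ τ₁ p.1 p.2) ∧
    (∃! p : ℝ × (Fin N₂ → ℝ), MAC.IsWaterFilling q sigmaR deltaR t₂ τ₂ p.1 p.2) ∧
    -- the optimal sequences are exactly those of the stated form with water-filling loadings
    (∀ (S₁ : Matrix (Fin N₁) (Fin L) ℂ) (S₂ : Matrix (Fin N₂) (Fin L) ℂ),
      MAC.IsOptimal Z₁ Z₂ q sigmaR deltaR τ₁ τ₂ S₁ S₂ ↔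
        ∃ (lam₁ lam₂ : ℝ) (s₁ : Fin N₁ → ℝ) (s₂ : Fin N₂ → ℝ)
          (V₁ : Matrix (Fin L) (Fin N₁) ℂ) (V₂ : Matrix (Fin L) (Fin N₂) ℂ),
          MAC.IsWaterFilling q sigmaR deltaR t₁ τ₁ lam₁ s₁ ∧
          MAC.IsWaterFilling q sigmaR deltaR t₂ τ₂ lam₂ s₂ ∧
          V₁ᴴ * V₁ = 1 ∧ V₂ᴴ * V₂ = 1 ∧ V₁ᴴ * V₂ = 0 ∧
          MAC.HasForm U₁ s₁ V₁ S₁ ∧ MAC.HasForm U₂ s₂ V₂ S₂) := by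
  have ht₁ : ∀ m, 0 < t₁ m := MAC.pos_of_specMat_posDef hU₁.1 (by rw [hU₁.2] at hZ₁; exact hZ₁)
  have ht₂ : ∀ m, 0 < t₂ m := MAC.pos_of_specMat_posDef hU₂.1 (by rw [hU₂.2] at hZ₂; exact hZ₂)
  have hδ : ∀ n, 0 < deltaR n := MAC.pos_of_specMat_posDef hKrU.1 (by rw [hKrU.2] at hKr; exact hKr)
  have hσ : ∀ n, 0 ≤ sigmaR n := MAC.nonneg_of_specMat_posSemidef hZrU.1 (by rw [hZrU.2] at hZr; exact hZr)
  have hα : ∀ n, 0 ≤ MAC.alpha q sigmaR deltaR n := fun n =>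
    div_nonneg (hσ n) (mul_pos hq (hδ n)).le
  -- Otherwise all eigenvalues of `Zr` vanish, contradicting `Zr ≠ 0`. This index makes the
  -- minimizing Gram matrix unique.
  have hpos : ∃ n, 0 < sigmaR n ∧ 0 < MAC.alpha q sigmaR deltaR n := by
    by_contra! hc
    refine hZr0 ?_
    have h0 : ∀ n, sigmaR n = 0 := fun n => by
      by_contra hne
      have h1 : 0 < sigmaR n := (hσ n).lt_of_ne' hne
      exact (hc n h1).not_gt (div_pos h1 (mul_pos hq (hδ n)))
    rw [hZrU.2]
    simp [h0]
  have hw₁ := MAC.existsUnique_isWaterFilling hσ hα hpos hN₁ ht₁ hτ₁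
  have hw₂ := MAC.existsUnique_isWaterFilling hσ hα hpos hN₂ ht₂ hτ₂
  have hopt : ∀ {lam₁ lam₂ : ℝ} {s₁ : Fin N₁ → ℝ} {s₂ : Fin N₂ → ℝ}
      {S₁ : Matrix (Fin N₁) (Fin L) ℂ} {S₂ : Matrix (Fin N₂) (Fin L) ℂ},
      MAC.IsWaterFilling q sigmaR deltaR t₁ τ₁ lam₁ s₁ →
      MAC.IsWaterFilling q sigmaR deltaR t₂ τ₂ lam₂ s₂ →
      MAC.gram S₁ S₂ = MAC.specMat (Matrix.fromBlocks U₁ 0 0 U₂)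
        (fun k => Sum.elim s₁ s₂ k ^ 2) →
      MAC.IsOptimal Z₁ Z₂ q sigmaR deltaR τ₁ τ₂ S₁ S₂ := by
    intro lam₁ lam₂ s₁ s₂ S₁ S₂ hs₁ hs₂ hS
    have hfeas := (MAC.feasible_of_gram_eq hU₁.1 hU₂.1 hS).1
    rw [hs₁.power, hs₂.power] at hfeas
    exact ⟨hfeas, fun T₁ T₂ hT =>
      (MAC.mse_optimality hN₁ hN₂ hU₁ ht₁ hU₂ ht₂ hσ hα hpos hs₁ hs₂ hS hT).1⟩
  obtain ⟨⟨lam₁, s₁⟩, hs₁, -⟩ := id hw₁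
  obtain ⟨⟨lam₂, s₂⟩, hs₂, -⟩ := id hw₂
  obtain ⟨S₁, S₂, hS⟩ : ∃ (S₁ : Matrix (Fin N₁) (Fin L) ℂ) (S₂ : Matrix (Fin N₂) (Fin L) ℂ),
      MAC.gram S₁ S₂ = MAC.specMat (Matrix.fromBlocks U₁ 0 0 U₂)
        (fun k => Sum.elim s₁ s₂ k ^ 2) := by
    -- Zero sources with zero loadings satisfy the Gram identity trivially, so the characterization
    -- yields jointly orthonormal `V₁`, `V₂`, which then carry the loadings `s₁`, `s₂`.
    obtain ⟨V₁, V₂, a, b, c, -⟩ := (MAC.gram_eq_specMat_iff hL hU₁.1 hU₂.1 0 0 0 0).1 (by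
      simp [MAC.gram_eq_fromBlocks, MAC.specMat, MAC.conj, ← Pi.zero_def])
    exact ⟨_, _, (MAC.gram_eq_specMat_iff hL hU₁.1 hU₂.1 s₁ s₂ _ _).2
      ⟨V₁, V₂, a, b, c, rfl, rfl⟩⟩
  -- A minimizer does at least as well as the water-filling pair, so the equality case identifies
  -- its Gram matrix.
  have hgram : ∀ {T₁ : Matrix (Fin N₁) (Fin L) ℂ} {T₂ : Matrix (Fin N₂) (Fin L) ℂ},
      MAC.IsOptimal Z₁ Z₂ q sigmaR deltaR τ₁ τ₂ T₁ T₂ →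
      MAC.gram T₁ T₂ = MAC.specMat (Matrix.fromBlocks U₁ 0 0 U₂)
        (fun k => Sum.elim s₁ s₂ k ^ 2) := fun hT =>
    ((MAC.mse_optimality hN₁ hN₂ hU₁ ht₁ hU₂ ht₂ hσ hα hpos hs₁ hs₂ hS hT.1).2
      (hT.2 _ _ (hopt hs₁ hs₂ hS).1)).trans hS
  refine ⟨⟨S₁, S₂, hopt hs₁ hs₂ hS⟩,
    fun T₁ T₂ hT => (MAC.feasible_of_gram_eq hU₁.1 hU₂.1 (hgram hT)).2, hw₁, hw₂,
    fun T₁ T₂ => ⟨fun hT => ?_, ?_⟩⟩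
  · obtain ⟨V₁, V₂, h⟩ := (MAC.gram_eq_specMat_iff hL hU₁.1 hU₂.1 s₁ s₂ T₁ T₂).1 (hgram hT)
    exact ⟨lam₁, lam₂, s₁, s₂, V₁, V₂, hs₁, hs₂, h⟩
  · rintro ⟨l₁, l₂, r₁, r₂, V₁, V₂, hr₁, hr₂, h⟩
    exact hopt hr₁ hr₂ ((MAC.gram_eq_specMat_iff hL hU₁.1 hU₂.1 r₁ r₂ T₁ T₂).2 ⟨V₁, V₂, h⟩)
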